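/- Let $n \ge 3$ and let $\mathrm{St}_n(\mathbb{Z})$ be the Steinberg group of the integers, i.e. the group generated by symbols $x_{ij}(r)$ for $1 \le i, j \le n$, $i \neq j$, $r \in \mathbb{Z}$, subject to the relations 1. $x_{ij}(r)\,x_{ij}(s) = x_{ij}(r+s)$ for $i \ne j$; 2. $[x_{ij}(r), x_{jk}(s)] = x_{ik}(rs)$ for $i, j, k$ pairwise distinct; 3. $[x_{ij}(r), x_{pq}(s)] = 1$ for $i \ne j$, $p \ne q$ with $j \neq p$ and $i \neq q$, where $[x,y] = xyx^{-1}y^{-1}$. Then for every integer $k$ with $0 \le k \le n-1$, every group homomorphism $f : \mathrm{St}_n(\mathbb{Z}) \to \mathrm{GL}_k(\mathbb{Z})$ is trivial. -/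

import Mathlib

open scoped commutatorElement

/-- Symbols `x_{ij}(r)` with `1 ≤ i ≠ j ≤ n` and `r ∈ R`. -/
structure SteinbergGen (n : ℕ) (R : Type*) where
  i : Fin n
  j : Fin n
  ne : i ≠ j
  r : R

/-- The symbol `x_{ij}(r)` as an element of the free group on all such symbols. -/
def steinbergX {n : ℕ} {R : Type*} (i j : Fin n) (h : i ≠ j) (r : R) :
    FreeGroup (SteinbergGen n R) :=
  FreeGroup.of ⟨i, j, h, r⟩

/-- The Steinberg relators; the commutator is `⁅x, y⁆ = x * y * x⁻¹ * y⁻¹`. -/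
inductive SteinbergRel (n : ℕ) (R : Type*) [Ring R] : FreeGroup (SteinbergGen n R) → Prop
  | add (i j : Fin n) (h : i ≠ j) (r s : R) :
      SteinbergRel n R
        (steinbergX i j h r * steinbergX i j h s * (steinbergX i j h (r + s))⁻¹)
  | comm_mul (i j k : Fin n) (hij : i ≠ j) (hjk : j ≠ k) (hik : i ≠ k) (r s : R) :
      SteinbergRel n R
        (⁅steinbergX i j hij r, steinbergX j k hjk s⁆ * (steinbergX i k hik (r * s))⁻¹)
  | comm_one (i j p q : Fin n) (hij : i ≠ j) (hpq : p ≠ q) (hjp : j ≠ p) (hiq : i ≠ q)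
      (r s : R) :
      SteinbergRel n R ⁅steinbergX i j hij r, steinbergX p q hpq s⁆

/-- The Steinberg group `St_n(R)`. -/
abbrev SteinbergGroup (n : ℕ) (R : Type*) [Ring R] : Type _ :=
  PresentedGroup {w : FreeGroup (SteinbergGen n R) | SteinbergRel n R w}

/-!
Let `V` be a representation of dimension less than `n` over an algebraically closed field. The
commuting elements `x_{0j}(r)`, `j ≠ 0`, have a joint eigenvector. Conjugation by `x_{ip}(1)`,
with `i, p ≠ 0`, multiplies the `i`-th coordinate of a joint eigenvalue by the `p`-th one, so a
nontrivial joint eigenvalue would produce `n` distinct ones, more than `dim V`. Hence the vectors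
fixed by row `0` form a nonzero subspace `W`, which the Steinberg group on the indices `≠ 0`
preserves. If `W = V`, then row `0` acts trivially. Otherwise, by induction on `n`, that smaller
group acts trivially on `W` and on `V / W`, hence through an abelian group, hence trivially as it
is perfect. In either case some `x_{ij}(1)` acts trivially, and its normal closure is the whole
group. The induction starts at `n = 3`, because in dimension two the centralizer of a non-scalar
endomorphism is commutative.

Over a commutative ring, the entries of the matrices `f (x_{ij}(1)) - 1` generate a finitely
generated ideal `I`, which lies in every maximal ideal by the case of fields. Since each `x_{ij}(1)`
is a commutator of two others, `I = I²`, and Nakayama's lemma gives `I = 0`.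
-/

section JointEigenvectors

variable {K V ι : Type*} [Field K] [AddCommGroup V] [Module K V]

theorem exists_joint_eigenvector [IsAlgClosed K] [FiniteDimensional K V] [Nontrivial V]
    (f : ι → Module.End K V) (hf : ∀ i j, Commute (f i) (f j)) :
    ∃ v ≠ 0, ∀ i, ∃ c : K, f i v = c • v := by
  induction hd : Module.finrank K V using Nat.strong_induction_on generalizing V with
  | _ d ih =>
    subst hd
    by_cases hscalar : ∀ i, ∃ c : K, ∀ v, f i v = c • v
    · obtain ⟨v, hv⟩ := exists_ne (0 : V)
      exact ⟨v, hv, fun i => (hscalar i).imp fun c hc => hc v⟩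
    push Not at hscalar
    obtain ⟨i, hi⟩ := hscalar
    obtain ⟨μ, hμ⟩ := Module.End.exists_eigenvalue (f i)
    let W := (f i).eigenspace μ
    have hWtop : W ≠ ⊤ := fun h => by
      obtain ⟨v, hv⟩ := hi μ
      exact hv (Module.End.mem_eigenspace_iff.1 (h ▸ Submodule.mem_top : v ∈ W))
    have hW (j : ι) : ∀ v ∈ W, f j v ∈ W := Module.End.mapsTo_genEigenspace_of_comm (hf i j) μ 1
    have : Nontrivial W := Submodule.nontrivial_iff_ne_bot.2 hμ
    obtain ⟨w, hw, hfw⟩ := ih _ (Submodule.finrank_lt hWtop) (fun j => (f j).restrict (hW j))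
      (fun j k => by ext v; exact LinearMap.congr_fun (hf j k).eq v) rfl
    exact ⟨w, by simpa using hw, fun j => (hfw j).imp fun c hc => congrArg Subtype.val hc⟩

theorem linearIndependent_of_joint_eigenvectors {κ : Type*} {f : ι → Module.End K V}
    (hf : ∀ i j, Commute (f i) (f j)) {χ : κ → ι → K} (hχ : Function.Injective χ) {v : κ → V}
    (hv : ∀ c, v c ≠ 0) (hfv : ∀ c i, f i (v c) = χ c i • v c) : LinearIndependent K v := by
  have hind := (Module.End.independent_iInf_maxGenEigenspace_of_forall_mapsTo f
    fun i j μ => Module.End.mapsTo_maxGenEigenspace_of_comm (hf j i) μ).comp hχ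
  refine hind.linearIndependent _ (fun c => (Submodule.mem_iInf _).2 fun i => ?_) hv
  exact (Module.End.mem_maxGenEigenspace _ _ _).2 ⟨1, by simp [hfv c i]⟩

end JointEigenvectors

theorem injective_option_elim_update {ι α : Type*} [DecidableEq ι] {b c : ι → α}
    (hc : ∀ i, c i ≠ b i) :
    Function.Injective fun o : Option ι => o.elim b fun i => Function.update b i (c i) := by
  rintro (_ | i) (_ | j) h
  · rfl
  · exact absurd (by simpa using (congrFun h j).symm) (hc j)
  · exact absurd (by simpa using congrFun h i) (hc i)
  · by_contra hij
    have hij : i ≠ j := fun h => hij (congrArg some h)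
    exact hc i (by simpa [Function.update_of_ne hij] using congrFun h i)

section UpdateMul

variable {ι H : Type*} [DecidableEq ι] [Group H] {X : Set (ι → H)} {a : ι → H}

theorem exists_forall_ne_one_of_update_mul_mem [Finite ι]
    (hX : ∀ a ∈ X, ∀ i j, i ≠ j → Function.update a i (a i * a j) ∈ X) (ha : a ∈ X)
    (ha1 : a ≠ 1) : ∃ b ∈ X, ∀ i, b i ≠ 1 := by
  have := Fintype.ofFinite ι
  obtain ⟨p, hp⟩ := Function.ne_iff.1 ha1
  suffices ∀ s : Finset ι, ∃ b ∈ X, b p ≠ 1 ∧ ∀ i ∈ s, b i ≠ 1 by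
    obtain ⟨b, hb, -, hb1⟩ := this Finset.univ
    exact ⟨b, hb, fun i => hb1 i (Finset.mem_univ i)⟩
  intro s
  induction s using Finset.induction_on with
  | empty => exact ⟨a, ha, hp, by simp⟩
  | insert j s _ ih =>
    obtain ⟨b, hb, hbp, hbs⟩ := ih
    by_cases hbj : b j = 1
    · have hjp : j ≠ p := fun h => hbp (h ▸ hbj)
      refine ⟨_, hX b hb j p hjp, by rwa [Function.update_of_ne hjp.symm], fun i hi => ?_⟩
      rcases eq_or_ne i j with rfl | hij
      · simpa [hbj] using hbp
      · rw [Function.update_of_ne hij]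
        exact hbs i (Finset.mem_of_mem_insert_of_ne hi hij)
    · exact ⟨b, hb, hbp, fun i hi => (Finset.mem_insert.1 hi).elim (fun h => h ▸ hbj) (hbs i)⟩

/-- The `card ι + 1` elements are some `b ∈ X` with no trivial coordinate and the elements that
differ from it in a single coordinate. -/
theorem exists_injective_option_of_update_mul_mem [Finite ι] [Nontrivial ι]
    (hX : ∀ a ∈ X, ∀ i j, i ≠ j → Function.update a i (a i * a j) ∈ X) (ha : a ∈ X)
    (ha1 : a ≠ 1) : ∃ χ : Option ι → ι → H, Function.Injective χ ∧ ∀ o, χ o ∈ X := by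
  obtain ⟨b, hb, hb1⟩ := exists_forall_ne_one_of_update_mul_mem hX ha ha1
  choose p hp using fun i : ι => exists_ne i
  refine ⟨_, injective_option_elim_update (b := b) (c := fun i => b i * b (p i)) fun i h =>
    hb1 _ (mul_eq_left.1 h), ?_⟩
  rintro (_ | i)
  · exact hb
  · exact hX b hb i _ (hp i).symm

end UpdateMul

theorem commute_of_commute_of_finrank_le_two {K V : Type*} [Field K] [AddCommGroup V] [Module K V]
    [FiniteDimensional K V] (hV : Module.finrank K V ≤ 2) {c f g : Module.End K V}
    (hc : ∀ a : K, c ≠ a • 1) (hf : Commute c f) (hg : Commute c g) : Commute f g := by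
  obtain ⟨v, hv⟩ : ∃ v, LinearIndependent K ![v, c v] := by
    by_contra! h
    obtain ⟨a, ha⟩ := LinearMap.exists_eq_smul_id_of_forall_notLinearIndependent h
    exact hc a ha
  have hspan : Submodule.span K {v, c v} = ⊤ := by
    have := hv.span_eq_top_of_card_eq_finrank' (hv.fintype_card_le_finrank.antisymm (by simpa))
    rwa [Matrix.range_cons_cons_empty] at this
  obtain ⟨a, b, hab⟩ := Submodule.mem_span_pair.1 (hspan ▸ Submodule.mem_top : f v ∈ _)
  have hcf (u : V) : c (f u) = f (c u) := LinearMap.congr_fun hf.eq u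
  have hf_eq : f = a • 1 + b • c := by
    refine LinearMap.ext_on hspan ?_
    rintro _ (rfl | rfl)
    · simpa using hab.symm
    · simp [← hcf, ← hab]
  rw [hf_eq]
  exact ((Commute.one_left g).smul_left a).add_left (hg.smul_left b)

theorem map_commutatorElement_eq_one_of_commute {G M : Type*} [Group G] [Monoid M] (f : G →* M)
    {g h : G} (hgh : Commute (f g) (f h)) : f ⁅g, h⁆ = 1 := by
  have hunit : IsUnit (f (h * g)) := (Group.isUnit _).map f
  refine hunit.mul_eq_right.1 ?_
  have hmul : ⁅g, h⁆ * (h * g) = g * h := by simp [commutatorElement_def, mul_assoc]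
  rw [← map_mul, hmul, map_mul, map_mul, hgh.eq]

theorem representation_eq_one_of_subrepresentation_of_quotient {k G V : Type*} [CommRing k]
    [Group G] [Group.IsPerfect G] [AddCommGroup V] [Module k V] (ρ : Representation k G V)
    (W : Submodule k V) (hW : ∀ g, W ≤ W.comap (ρ g)) (hsub : ρ.subrepresentation W hW = 1)
    (hquot : ρ.quotient W hW = 1) : ρ = 1 := by
  have fixed (g : G) (w : V) (hw : w ∈ W) : ρ g w = w :=
    congrArg Subtype.val (LinearMap.congr_fun (DFunLike.congr_fun hsub g) ⟨w, hw⟩)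
  have sub_mem (g : G) (v : V) : ρ g v - v ∈ W :=
    (Submodule.Quotient.eq W).1 (LinearMap.congr_fun (DFunLike.congr_fun hquot g) (W.mkQ v))
  have commute (g h : G) : Commute (ρ g) (ρ h) := by
    ext v
    have hg := fixed g _ (sub_mem h v)
    have hh := fixed h _ (sub_mem g v)
    rw [map_sub, sub_eq_iff_eq_add] at hg hh
    rw [Module.End.mul_apply, Module.End.mul_apply, hg, hh]
    abel
  have hker : commutator G ≤ ρ.ker :=
    Subgroup.commutator_le.2 fun g _ h _ => map_commutatorElement_eq_one_of_commute ρ (commute g h)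
  exact MonoidHom.ext fun g => hker Group.IsPerfect.mem_commutator

namespace SteinbergGroup

variable {R : Type*} [Ring R]

section Generators

variable {n : ℕ}

/-- The element `x_{ij}(r)` of the Steinberg group. -/
def x {i j : Fin n} (hij : i ≠ j) (r : R) : SteinbergGroup n R :=
  PresentedGroup.of ⟨i, j, hij, r⟩

theorem x_add {i j : Fin n} (hij : i ≠ j) (r s : R) : x hij (r + s) = x hij r * x hij s := by
  have := PresentedGroup.one_of_mem
    (rels := {w : FreeGroup (SteinbergGen n R) | SteinbergRel n R w})
    (SteinbergRel.add i j hij r s)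
  rw [map_mul, map_inv, mul_inv_eq_one, map_mul] at this
  exact this.symm

theorem commutator_x {i j k : Fin n} (hij : i ≠ j) (hjk : j ≠ k) (hik : i ≠ k) (r s : R) :
    ⁅x hij r, x hjk s⁆ = x hik (r * s) := by
  have := PresentedGroup.one_of_mem
    (rels := {w : FreeGroup (SteinbergGen n R) | SteinbergRel n R w})
    (SteinbergRel.comm_mul i j k hij hjk hik r s)
  rwa [map_mul, map_inv, mul_inv_eq_one, map_commutatorElement] at this

theorem commute_x {i j p q : Fin n} (hij : i ≠ j) (hpq : p ≠ q) (hjp : j ≠ p) (hiq : i ≠ q)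
    (r s : R) : Commute (x hij r) (x hpq s) := by
  have := PresentedGroup.one_of_mem
    (rels := {w : FreeGroup (SteinbergGen n R) | SteinbergRel n R w})
    (SteinbergRel.comm_one i j p q hij hpq hjp hiq r s)
  rw [map_commutatorElement] at this
  exact commutatorElement_eq_one_iff_commute.1 this

theorem x_neg {i j : Fin n} (hij : i ≠ j) (r : R) : x hij (-r) = (x hij r)⁻¹ := by
  have x_zero : x hij (0 : R) = 1 := by simpa using x_add hij (0 : R) 0
  rw [eq_inv_iff_mul_eq_one, ← x_add, neg_add_cancel, x_zero]

theorem submonoid_eq_top {S : Submonoid (SteinbergGroup n R)}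
    (hS : ∀ (i j : Fin n) (hij : i ≠ j) (r : R), x hij r ∈ S) : S = ⊤ := by
  let S' : Subgroup (SteinbergGroup n R) :=
    Subgroup.closure (Set.range fun g : SteinbergGen n R => x g.ne g.r)
  have hS' : S' = ⊤ := PresentedGroup.closure_range_of _
  rw [eq_top_iff, ← Subgroup.top_toSubmonoid, ← hS', Subgroup.closure_toSubmonoid,
    Submonoid.closure_le, Set.union_subset_iff]
  constructor
  · rintro _ ⟨g, rfl⟩
    exact hS _ _ _ _
  · rintro g ⟨⟨i, j, hij, r⟩, hg⟩
    rw [← inv_inv g, ← hg, ← x_neg]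
    exact hS _ _ _ _

theorem normal_eq_top {N : Subgroup (SteinbergGroup n R)} [N.Normal] (hn : 3 ≤ n) {a b : Fin n}
    (hab : a ≠ b) (hN : x hab (1 : R) ∈ N) : N = ⊤ := by
  have mem_of_left {i j k : Fin n} (hij : i ≠ j) (hjk : j ≠ k) (hik : i ≠ k) {r s : R}
      (h : x hij r ∈ N) : x hik (r * s) ∈ N :=
    commutator_x hij hjk hik r s ▸ Subgroup.commutator_le_left N ⊤
      (Subgroup.commutator_mem_commutator h (Subgroup.mem_top _))
  have mem_of_right {i j k : Fin n} (hij : i ≠ j) (hjk : j ≠ k) (hik : i ≠ k) {r s : R}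
      (h : x hjk s ∈ N) : x hik (r * s) ∈ N :=
    commutator_x hij hjk hik r s ▸ Subgroup.commutator_le_right ⊤ N
      (Subgroup.commutator_mem_commutator (Subgroup.mem_top _) h)
  have row_one {j : Fin n} (haj : a ≠ j) : x haj (1 : R) ∈ N := by
    rcases eq_or_ne b j with rfl | hbj
    · exact hN
    · simpa using mem_of_left (s := 1) hab hbj haj hN
  have off_row {i j : Fin n} (hij : i ≠ j) (hia : i ≠ a) (haj : a ≠ j) (r : R) : x hij r ∈ N := by
    simpa using mem_of_right (r := r) hia haj hij (row_one haj)
  have hN_top : N.toSubmonoid = ⊤ := submonoid_eq_top fun i j hij r => by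
    obtain ⟨l, hli, hlj⟩ := Fin.exists_ne_and_ne_of_two_lt i j hn
    rcases eq_or_ne i a with rfl | hia
    · simpa using mem_of_left (s := r) hli.symm hlj hij (row_one hli.symm)
    rcases eq_or_ne a j with rfl | haj
    · simpa using mem_of_left (s := 1) hli.symm hlj hij (off_row hli.symm hia hlj.symm r)
    · exact off_row hij hia haj r
  exact Subgroup.toSubmonoid_injective hN_top

theorem hom_eq_one {M : Type*} [Monoid M] (f : SteinbergGroup n R →* M) (hn : 3 ≤ n) {a b : Fin n}
    (hab : a ≠ b) (hf : f (x hab 1) = 1) : f = 1 :=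
  MonoidHom.ker_eq_top_iff.1 (normal_eq_top hn hab hf)

theorem exists_commutator_eq_x_one (hn : 3 ≤ n) {i j : Fin n} (hij : i ≠ j) :
    ∃ (l : Fin n) (hil : i ≠ l) (hlj : l ≠ j), x hij (1 : R) = ⁅x hil (1 : R), x hlj 1⁆ := by
  obtain ⟨l, hli, hlj⟩ := Fin.exists_ne_and_ne_of_two_lt i j hn
  exact ⟨l, hli.symm, hlj, by rw [commutator_x hli.symm hlj hij, mul_one]⟩

theorem isPerfect (hn : 3 ≤ n) : Group.IsPerfect (SteinbergGroup n R) where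
  commutator_eq_top := by
    have h01 : (⟨0, by omega⟩ : Fin n) ≠ ⟨1, by omega⟩ := by simp
    refine normal_eq_top hn h01 ?_
    obtain ⟨l, h0l, hl1, hx⟩ := exists_commutator_eq_x_one (R := R) hn h01
    exact hx ▸ Subgroup.commutator_mem_commutator (Subgroup.mem_top _) (Subgroup.mem_top _)

/-- The homomorphism `x_{ij}(r) ↦ x_{e(i)e(j)}(r)` induced by an injection `e` of the indices. -/
def map {m : ℕ} (e : Fin m ↪ Fin n) : SteinbergGroup m R →* SteinbergGroup n R :=
  PresentedGroup.toGroup (f := fun g => x (e.injective.ne g.ne) g.r) <| by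
    rintro _ (⟨i, j, hij, r, s⟩ | ⟨i, j, k, hij, hjk, hik, r, s⟩ |
        ⟨i, j, p, q, hij, hpq, hjp, hiq, r, s⟩) <;>
      simp only [steinbergX, map_mul, map_inv, map_commutatorElement, FreeGroup.lift_apply_of]
    · exact mul_inv_eq_one.2 (x_add _ r s).symm
    · exact mul_inv_eq_one.2 (commutator_x _ _ _ r s)
    · exact commutatorElement_eq_one_iff_commute.2
        (commute_x _ _ (e.injective.ne hjp) (e.injective.ne hiq) r s)

theorem map_x {m : ℕ} (e : Fin m ↪ Fin n) {i j : Fin m} (hij : i ≠ j) (r : R) :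
    map e (x hij r) = x (e.injective.ne hij) r :=
  PresentedGroup.toGroup.of _

theorem representation_eq_one_of_finrank_le_two {K V : Type*} [Field K] [AddCommGroup V]
    [Module K V] [FiniteDimensional K V] (ρ : Representation K (SteinbergGroup n R) V)
    (hn : 3 ≤ n) (hV : Module.finrank K V ≤ 2) : ρ = 1 := by
  let i : Fin n := ⟨0, by omega⟩
  let j : Fin n := ⟨1, by omega⟩
  let l : Fin n := ⟨2, by omega⟩
  have hij : i ≠ j := by simp [i, j]
  have hil : i ≠ l := by simp [i, l]
  have hjl : j ≠ l := by simp [j, l]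
  by_cases hscalar : ∃ a : K, ρ (x hil 1) = a • 1
  · obtain ⟨a, ha⟩ := hscalar
    refine hom_eq_one ρ hn hij ?_
    have : Commute (ρ (x hil 1)) (ρ (x hjl.symm 1)) := ha ▸ (Commute.one_left _).smul_left a
    simpa [commutator_x hil hjl.symm hij] using map_commutatorElement_eq_one_of_commute ρ this
  · refine hom_eq_one ρ hn hil ?_
    have : Commute (ρ (x hij 1)) (ρ (x hjl 1)) :=
      commute_of_commute_of_finrank_le_two hV (not_exists.1 hscalar)
        ((commute_x hil hij hil.symm hij 1 1).map ρ) ((commute_x hil hjl hjl.symm hil 1 1).map ρ)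
    simpa [commutator_x hij hjl hil] using map_commutatorElement_eq_one_of_commute ρ this

end Generators

section RowWeights

variable {K V : Type*} [Field K] [AddCommGroup V] [Module K V] {m : ℕ}

/-- The element `x_{0,j+1}(r)`, off-diagonal in row `0`; these generate an abelian subgroup,
normalized by the Steinberg group on the remaining indices. -/
def rowX (j : Fin m) (r : R) : SteinbergGroup (m + 1) R :=
  x (Fin.succ_ne_zero j).symm r

theorem commute_rowX (i j : Fin m) (r s : R) : Commute (rowX i r) (rowX j s) :=
  commute_x _ _ (Fin.succ_ne_zero i) (Fin.succ_ne_zero j).symm r s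

theorem commute_rowX_map_succ {i j p : Fin m} (hip : i ≠ p) (hji : j ≠ i) (r s : R) :
    Commute (rowX j r) (map (Fin.succEmb m) (x hip s)) := by
  rw [map_x]
  exact commute_x _ _ (by simpa using hji) (Fin.succ_ne_zero p).symm r s

theorem rowX_mul_map_succ {i p : Fin m} (hip : i ≠ p) (r s : R) :
    rowX i r * map (Fin.succEmb m) (x hip s) =
      rowX p (r * s) * map (Fin.succEmb m) (x hip s) * rowX i r := by
  rw [map_x, rowX, rowX, ← mul_inv_eq_iff_eq_mul, ← mul_inv_eq_iff_eq_mul]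
  exact commutator_x _ _ _ r s

/-- The joint eigenspace of the row elements `x_{0,j+1}(r)` for the eigenvalues `a j r`. -/
def rowWeightSpace (ρ : Representation K (SteinbergGroup (m + 1) R) V) (a : Fin m → R → Kˣ) :
    Submodule K V :=
  ⨅ (j) (r), Module.End.eigenspace (ρ (rowX j r)) (a j r : K)

theorem mem_rowWeightSpace {ρ : Representation K (SteinbergGroup (m + 1) R) V}
    {a : Fin m → R → Kˣ} {v : V} :
    v ∈ rowWeightSpace ρ a ↔ ∀ j r, ρ (rowX j r) v = (a j r : K) • v := by
  simp [rowWeightSpace]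

variable (ρ : Representation K (SteinbergGroup (m + 1) R) V) {a : Fin m → R → Kˣ}

theorem map_succ_apply_mem_rowWeightSpace {v : V} (hv : v ∈ rowWeightSpace ρ a) {i p : Fin m}
    (hip : i ≠ p) (s : R) :
    ρ (map (Fin.succEmb m) (x hip s)) v ∈
      rowWeightSpace ρ (Function.update a i fun r => a i r * a p (r * s)) := by
  rw [mem_rowWeightSpace] at hv ⊢
  have apply_of_ne {j : Fin m} (hji : j ≠ i) (r : R) :
      ρ (rowX j r) (ρ (map (Fin.succEmb m) (x hip s)) v) =
        (a j r : K) • ρ (map (Fin.succEmb m) (x hip s)) v := by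
    rw [← Module.End.mul_apply, ((commute_rowX_map_succ hip hji r s).map ρ).eq,
      Module.End.mul_apply, hv, map_smul]
  intro j r
  rcases eq_or_ne j i with rfl | hji
  · rw [← Module.End.mul_apply, ← map_mul, rowX_mul_map_succ, map_mul, map_mul,
      Module.End.mul_apply, Module.End.mul_apply, hv, map_smul, map_smul, apply_of_ne hip.symm,
      smul_smul, Function.update_self, Units.val_mul]
  · rw [Function.update_of_ne hji, apply_of_ne hji]

theorem rowWeightSpace_update_ne_bot (ha : rowWeightSpace ρ a ≠ ⊥) {i p : Fin m} (hip : i ≠ p) :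
    rowWeightSpace ρ (Function.update a i (a i * a p)) ≠ ⊥ := by
  obtain ⟨v, hv, hv0⟩ := (Submodule.ne_bot_iff _).1 ha
  have hmem := map_succ_apply_mem_rowWeightSpace ρ hv hip 1
  simp only [mul_one] at hmem
  exact (Submodule.ne_bot_iff _).2
    ⟨_, hmem, (map_ne_zero_iff _ (ρ.apply_bijective _).injective).2 hv0⟩

theorem exists_rowWeightSpace_ne_bot [IsAlgClosed K] [FiniteDimensional K V] [Nontrivial V] :
    ∃ a, rowWeightSpace ρ a ≠ ⊥ := by
  obtain ⟨v, hv, h⟩ := exists_joint_eigenvector (fun p : Fin m × R => ρ (rowX p.1 p.2))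
    fun p q => (commute_rowX p.1 q.1 p.2 q.2).map ρ
  choose c hc using h
  have hc0 (p : Fin m × R) : c p ≠ 0 := fun h0 =>
    (map_ne_zero_iff _ (ρ.apply_bijective (rowX p.1 p.2)).injective).2 hv
      (by rw [hc, h0, zero_smul])
  exact ⟨fun j r => Units.mk0 (c (j, r)) (hc0 _),
    (Submodule.ne_bot_iff _).2 ⟨v, mem_rowWeightSpace.2 fun j r => hc (j, r), hv⟩⟩

theorem card_le_finrank_of_rowWeightSpace_ne_bot [FiniteDimensional K V] {κ : Type*} [Fintype κ]
    {χ : κ → Fin m → R → Kˣ} (hχ : Function.Injective χ) (h : ∀ c, rowWeightSpace ρ (χ c) ≠ ⊥) :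
    Fintype.card κ ≤ Module.finrank K V := by
  choose v hv hv0 using fun c => (Submodule.ne_bot_iff _).1 (h c)
  refine (linearIndependent_of_joint_eigenvectors (f := fun p : Fin m × R => ρ (rowX p.1 p.2))
    (χ := fun c p => χ c p.1 p.2) (fun p q => (commute_rowX p.1 q.1 p.2 q.2).map ρ) ?_ hv0
    fun c p => mem_rowWeightSpace.1 (hv c) p.1 p.2).fintype_card_le_finrank
  intro c d hcd
  exact hχ (funext₂ fun j r => Units.ext (congrFun hcd (j, r)))

theorem rowWeightSpace_one_ne_bot [IsAlgClosed K] [FiniteDimensional K V] [Nontrivial V]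
    (hm : 2 ≤ m) (hV : Module.finrank K V ≤ m) : rowWeightSpace ρ 1 ≠ ⊥ := by
  obtain ⟨a, ha⟩ := exists_rowWeightSpace_ne_bot ρ
  by_cases ha1 : a = 1
  · exact ha1 ▸ ha
  have : Nontrivial (Fin m) := Fin.nontrivial_iff_two_le.2 hm
  obtain ⟨χ, hχ, hχa⟩ := exists_injective_option_of_update_mul_mem
    (X := {a : Fin m → R → Kˣ | rowWeightSpace ρ a ≠ ⊥})
    (fun a ha i p => rowWeightSpace_update_ne_bot ρ ha) ha ha1
  have := card_le_finrank_of_rowWeightSpace_ne_bot ρ hχ hχa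
  rw [Fintype.card_option, Fintype.card_fin] at this
  omega

theorem rowWeightSpace_one_le_comap (g : SteinbergGroup m R) :
    rowWeightSpace ρ 1 ≤ (rowWeightSpace ρ 1).comap (ρ (map (Fin.succEmb m) g)) := by
  let S : Submonoid (SteinbergGroup m R) :=
    { carrier := {g | ∀ v ∈ rowWeightSpace ρ 1, ρ (map (Fin.succEmb m) g) v ∈ rowWeightSpace ρ 1}
      one_mem' := fun v hv => by simpa using hv
      mul_mem' := fun hg hh v hv => by simpa using hg _ (hh v hv) }
  have update_one (i : Fin m) : Function.update (1 : Fin m → R → Kˣ) i (fun _ => 1 * 1) = 1 := by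
    rw [mul_one]
    exact Function.update_eq_self i 1
  have hS : S = ⊤ := submonoid_eq_top fun i p hip s v hv =>
    update_one i ▸ map_succ_apply_mem_rowWeightSpace ρ hv hip s
  exact (hS ▸ Submonoid.mem_top g : g ∈ S)

end RowWeights

theorem representation_eq_one_of_finrank_lt {K : Type*} [Field K] [IsAlgClosed K] {n : ℕ}
    (hn : 3 ≤ n) {V : Type*} [AddCommGroup V] [Module K V] [FiniteDimensional K V]
    (hV : Module.finrank K V < n) (ρ : Representation K (SteinbergGroup n R) V) : ρ = 1 := by
  induction n, hn using Nat.le_induction generalizing V with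
  | base => exact representation_eq_one_of_finrank_le_two ρ le_rfl (by omega)
  | succ m hm ih =>
    rcases subsingleton_or_nontrivial V with _ | _
    · exact MonoidHom.ext fun _ => Subsingleton.elim _ _
    let W := rowWeightSpace ρ 1
    have hpos : 1 ≤ Module.finrank K W :=
      Submodule.one_le_finrank_iff.2 (rowWeightSpace_one_ne_bot ρ (by omega) (by omega))
    have hsum := W.finrank_quotient_add_finrank
    by_cases hW : W = ⊤
    · refine hom_eq_one ρ (by omega) (Fin.succ_ne_zero ⟨0, by omega⟩).symm ?_
      ext v
      simpa [rowX] using mem_rowWeightSpace.1 (hW ▸ Submodule.mem_top : v ∈ W) ⟨0, by omega⟩ 1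
    have hlt := Submodule.finrank_lt hW
    have := isPerfect (R := R) hm
    have hstab := rowWeightSpace_one_le_comap ρ
    have hinner : ρ.comp (map (Fin.succEmb m)) = 1 :=
      representation_eq_one_of_subrepresentation_of_quotient _ W hstab
        (ih (by omega) _) (ih (by omega) _)
    have h01 : (⟨0, by omega⟩ : Fin m) ≠ ⟨1, by omega⟩ := by simp
    refine hom_eq_one ρ (by omega) ((Fin.succEmb m).injective.ne h01) ?_
    rw [← map_x]
    exact DFunLike.congr_fun hinner (x h01 1)

theorem generalLinearGroup_hom_eq_one_of_isAlgClosed {K κ : Type*} [Field K] [IsAlgClosed K]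
    [Fintype κ] [DecidableEq κ] {n : ℕ} (hn : 3 ≤ n) (hκ : Fintype.card κ < n)
    (f : SteinbergGroup n R →* Matrix.GeneralLinearGroup κ K) : f = 1 := by
  let ρ : Representation K (SteinbergGroup n R) (κ → K) :=
    ((Units.coeHom _).comp Matrix.GeneralLinearGroup.toLin.toMonoidHom).comp f
  have hρ : ρ = 1 := representation_eq_one_of_finrank_lt hn (by simpa using hκ) ρ
  refine MonoidHom.ext fun g => ?_
  exact Matrix.GeneralLinearGroup.toLin.injective
    ((Units.ext (DFunLike.congr_fun hρ g)).trans (map_one _).symm)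

theorem generalLinearGroup_hom_eq_one {K κ : Type*} [Field K] [Fintype κ] [DecidableEq κ] {n : ℕ}
    (hn : 3 ≤ n) (hκ : Fintype.card κ < n)
    (f : SteinbergGroup n R →* Matrix.GeneralLinearGroup κ K) : f = 1 := by
  let φ : Matrix.GeneralLinearGroup κ K →* Matrix.GeneralLinearGroup κ (AlgebraicClosure K) :=
    Matrix.GeneralLinearGroup.map (algebraMap K _)
  have hφ : Function.Injective φ :=
    Units.map_injective (Matrix.map_injective (algebraMap K _).injective)
  refine MonoidHom.ext fun g => ?_
  have hφf : φ.comp f = 1 := generalLinearGroup_hom_eq_one_of_isAlgClosed hn hκ _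
  exact hφ ((DFunLike.congr_fun hφf g).trans (map_one φ).symm)

end SteinbergGroup

theorem val_commutatorElement_sub_one {A : Type*} [Ring A] (u v : Aˣ) :
    (⁅u, v⁆ : Aˣ).1 - 1 = ((u.1 - 1) * (v.1 - 1) - (v.1 - 1) * (u.1 - 1)) * ((v * u)⁻¹).1 := by
  have hmul : ⁅u, v⁆ * (v * u) = u * v := by simp [commutatorElement_def, mul_assoc]
  rw [Units.eq_mul_inv_iff_mul_eq, sub_mul, one_mul, ← Units.val_mul, hmul, Units.val_mul,
    Units.val_mul]
  noncomm_ring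

theorem generalLinearGroup_eq_one_of_eq_commutator {S ι κ : Type*} [CommRing S] [Finite ι]
    [Fintype κ] [DecidableEq κ] (u : ι → Matrix.GeneralLinearGroup κ S)
    (hcomm : ∀ i, ∃ j k, u i = ⁅u j, u k⁆)
    (hmax : ∀ M : Ideal S, M.IsMaximal →
      ∀ i, Matrix.GeneralLinearGroup.map (Ideal.Quotient.mk M) (u i) = 1) (i : ι) : u i = 1 := by
  let X (i : ι) : Matrix κ κ S := (u i).1 - 1
  let I : Ideal S := Ideal.span (Set.range fun p : ι × κ × κ => X p.1 p.2.1 p.2.2)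
  have hX (i : ι) (a b : κ) : X i a b ∈ I := Ideal.subset_span ⟨(i, a, b), rfl⟩
  have hX_mul (i j : ι) (a b : κ) : (X i * X j) a b ∈ I * I :=
    Ideal.sum_mem _ fun c _ => Ideal.mul_mem_mul (hX i a c) (hX j c b)
  have hle : I ≤ I * I := by
    rw [Ideal.span_le]
    rintro _ ⟨⟨i, a, b⟩, rfl⟩
    obtain ⟨j, k, hi⟩ := hcomm i
    have hX_eq : X i = (X j * X k - X k * X j) * ((u k * u j)⁻¹).1 :=
      (congrArg (fun t => t.1 - 1) hi).trans (val_commutatorElement_sub_one (u j) (u k))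
    change X i a b ∈ I * I
    rw [hX_eq]
    exact Ideal.sum_mem _ fun c _ =>
      Ideal.mul_mem_right _ _ (sub_mem (hX_mul j k a c) (hX_mul k j a c))
  have hjac : I ≤ Ideal.jacobson ⊥ := by
    refine le_sInf fun M ⟨_, hM⟩ => Ideal.span_le.2 ?_
    rintro _ ⟨⟨i, a, b⟩, rfl⟩
    have hmod : Ideal.Quotient.mk M ((u i).1 a b) = (1 : Matrix κ κ (S ⧸ M)) a b :=
      congrArg (fun t => t.1 a b) (hmax M hM i)
    refine Ideal.Quotient.eq.1 (hmod.trans ?_)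
    simp [Matrix.one_apply, apply_ite]
  have hI : I = ⊥ :=
    Submodule.eq_bot_of_le_smul_of_le_jacobson_bot I I (Submodule.fg_span (Set.finite_range _)) hle
      hjac
  refine Units.ext (sub_eq_zero.1 (Matrix.ext fun a b => ?_))
  have hX0 : X i a b = 0 := by simpa [hI] using hX i a b
  exact hX0

theorem mainTheorem5_general {R S κ : Type*} [Ring R] [CommRing S] [Fintype κ] [DecidableEq κ]
    {n : ℕ} (hn : 3 ≤ n) (hκ : Fintype.card κ < n)
    (f : SteinbergGroup n R →* Matrix.GeneralLinearGroup κ S) : f = 1 := by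
  let u (p : {p : Fin n × Fin n // p.1 ≠ p.2}) : Matrix.GeneralLinearGroup κ S :=
    f (SteinbergGroup.x p.2 1)
  have hcomm (p) : ∃ q q', u p = ⁅u q, u q'⁆ := by
    obtain ⟨l, hil, hlj, hx⟩ := SteinbergGroup.exists_commutator_eq_x_one (R := R) hn p.2
    exact ⟨⟨(_, l), hil⟩, ⟨(l, _), hlj⟩, by simp only [u, hx, map_commutatorElement]⟩
  have hmax (M : Ideal S) (hM : M.IsMaximal) (p) :
      Matrix.GeneralLinearGroup.map (Ideal.Quotient.mk M) (u p) = 1 := by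
    let := Ideal.Quotient.field M
    exact DFunLike.congr_fun (SteinbergGroup.generalLinearGroup_hom_eq_one hn hκ
      ((Matrix.GeneralLinearGroup.map (Ideal.Quotient.mk M)).comp f)) _
  have h01 : (⟨0, by omega⟩ : Fin n) ≠ ⟨1, by omega⟩ := by simp
  exact SteinbergGroup.hom_eq_one f hn h01
    (generalLinearGroup_eq_one_of_eq_commutator u hcomm hmax ⟨(_, _), h01⟩)

theorem mainTheorem5 (n k : ℕ) (hn : 3 ≤ n) (hk : k ≤ n - 1)
    (f : SteinbergGroup n ℤ →* Matrix.GeneralLinearGroup (Fin k) ℤ) :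
    f = 1 :=
  mainTheorem5_general hn (by rw [Fintype.card_fin]; omega) f
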